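/- Let $H$ be an infinite-dimensional complex Hilbert space (not necessarily separable), $\mathcal B(H)$ the algebra of bounded operators on $H$ and $\mathcal K(H)$ the ideal of compact operators. A symmetric quasi-Banach ideal of compact operators is a nonzero two-sided ideal $\mathcal I\subseteq\mathcal K(H)$ of $\mathcal B(H)$ with a complete quasi-norm $\|\cdot\|_{\mathcal I}$ such that $\|axb\|_{\mathcal I}\le\|a\|\,\|x\|_{\mathcal I}\,\|b\|$ for all $x\in\mathcal I$, $a,b\in\mathcal B(H)$, and $\|p\|_{\mathcal I}=1$ for every one-dimensional orthogonal projection $p\in\mathcal I$. For $x\in\mathcal K(H)$ let $s_1(x)\ge s_2(x)\ge\dots$ be its singular values, i.e. the eigenvalues of $|x|=(x^*x)^{1/2}$ in decreasing order, repeated according to multiplicity (and continued by zeros if $x$ has finite rank). For a bounded real sequence $\xi$ let $\xi^*$ be the decreasing rearrangement of $|\xi|$, that is, $\xi^*_n=\inf\{t>0:\#\{k:|\xi_k|>t\}\le n-1\}$ for $n\ge 1$. Let $c_0$ and $l_\infty$ be the spaces of real null sequences and of bounded real sequences. For an ideal $\mathcal I$ of compact operators put $$E_{\mathcal I}=\{\xi\in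 c_0:\ \xi^*=\{s_n(x)\}_{n=1}^\infty\text{ for some }x\in\mathcal I\}.$$ For $F,G\subseteq c_0$ put $F:G=\{\xi\in l_\infty:\ \xi\eta\in F\ \text{for all }\eta\in G\}$, with the coordinatewise product. For ideals $\mathcal I,\mathcal J$ of $\mathcal B(H)$ put $\mathcal J:\mathcal I=\{a\in\mathcal B(H):\ ax\in\mathcal J\ \text{for all }x\in\mathcal I\}$. **Proposition.** Let $\mathcal I$ and $\mathcal J$ be symmetric quasi-Banach ideals of compact operators on $H$ with $\mathcal I\not\subseteq\mathcal J$. Then $$\mathcal J:\mathcal I \;=\; C_{E_{\mathcal J}:E_{\mathcal I}} \;:=\; \bigl\{x\in\mathcal K(H):\ \{s_n(x)\}_{n=1}^\infty\in E_{\mathcal J}:E_{\mathcal I}\bigr\}.$$ -/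

import Mathlib

namespace QuasiBanachIdeals

noncomputable section

open Filter Topology

/-! ### Quasi-norms -/

/-- `q` is a quasi-norm on the complex vector space `X`. -/
structure IsQuasiNorm {X : Type*} [AddCommGroup X] [Module ℂ X] (q : X → ℝ) : Prop where
  nonneg : ∀ x, 0 ≤ q x
  eq_zero_iff : ∀ x, q x = 0 ↔ x = 0
  smul : ∀ (α : ℂ) (x : X), q (α • x) = ‖α‖ * q x
  add_le : ∃ C : ℝ, 1 ≤ C ∧ ∀ x y, q (x + y) ≤ C * (q x + q y)

/-- Completeness of a quasi-norm: every Cauchy sequence converges. -/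
def IsCompleteQuasiNorm {X : Type*} [AddCommGroup X] (q : X → ℝ) : Prop :=
  ∀ u : ℕ → X, (∀ ε : ℝ, 0 < ε → ∃ N : ℕ, ∀ m ≥ N, ∀ n ≥ N, q (u m - u n) < ε) →
    ∃ x : X, Tendsto (fun n => q (u n - x)) atTop (𝓝 0)

/-! ### Sequences -/

/-- The decreasing rearrangement `ξ*` of (the absolute value of) a bounded real sequence `ξ`,
indexed from `0`: `ξ*_n` is the infimum of all `t > 0` such that at most `n` of the numbers
`|ξ_k|` exceed `t`. -/
def rearrangement (ξ : ℕ → ℝ) (n : ℕ) : ℝ :=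
  sInf {t : ℝ | 0 < t ∧ {k : ℕ | t < |ξ k|}.encard ≤ n}

/-- The `F`-dual space `F : G` of `G`: the bounded real sequences that multiply `G` into `F`. -/
def seqDual (F G : Set (ℕ → ℝ)) : Set (ℕ → ℝ) :=
  {ξ | Memℓp ξ ⊤ ∧ ∀ η ∈ G, ξ * η ∈ F}

variable {H : Type*} [NormedAddCommGroup H] [InnerProductSpace ℂ H] [CompleteSpace H]

/-! ### Singular values -/

/-- The span of all eigenvectors of `|x| = (x* x)^(1/2)` to eigenvalues `> t`; its dimension is the
number of eigenvalues of `|x|` exceeding `t`, counted with multiplicity. -/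
def eigenspaceAbove (x : H →L[ℂ] H) (t : ℝ) : Submodule ℂ H :=
  ⨆ μ : {μ : ℝ // t < μ},
    Module.End.eigenspace ((CFC.abs x : H →L[ℂ] H) : H →ₗ[ℂ] H) ((μ : ℝ) : ℂ)

/-- The singular values of a compact operator `x`: the eigenvalues of `|x|`, arranged in decreasing
order and repeated according to multiplicity (followed by zeros if `|x|` has finite rank), indexed
from `0`. The `n`-th term of this arrangement is the infimum of all `t > 0` such that at most `n`
eigenvalues of `|x|`, counted with multiplicity, exceed `t`. -/
def singularValue (x : H →L[ℂ] H) (n : ℕ) : ℝ :=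
  sInf {t : ℝ | 0 < t ∧ Module.rank ℂ (eigenspaceAbove x t) ≤ (n : Cardinal)}

/-! ### Ideals of operators -/

/-- `(I, q)` is a symmetric quasi-Banach ideal of compact operators on `H`: a nonzero two-sided
ideal of `B(H)` that consists of compact operators, with a complete symmetric quasi-norm `q`. -/
structure IsSymmetricQuasiBanachIdeal (I : Ideal (H →L[ℂ] H)) (q : I → ℝ) : Prop where
  twoSided : I.IsTwoSided
  ne_bot : I ≠ ⊥
  compact : ∀ x ∈ I, IsCompactOperator x
  quasiNorm : IsQuasiNorm q
  complete : IsCompleteQuasiNorm q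
  /-- `‖a x b‖_I ≤ ‖a‖ ‖x‖_I ‖b‖`, where `y` is `a x b` as an element of `I`. -/
  symmetric : ∀ (a b : H →L[ℂ] H) (x y : I), (y : H →L[ℂ] H) = a * x * b →
    q y ≤ ‖a‖ * q x * ‖b‖
  /-- One-dimensional orthogonal projections are normalized. -/
  projection : ∀ p : I, IsStarProjection (p : H →L[ℂ] H) →
    Module.finrank ℂ ((p : H →L[ℂ] H) : H →ₗ[ℂ] H).range = 1 → q p = 1

/-- The `J`-dual space `J : I` of `I`. -/
def dualSpace (J I : Ideal (H →L[ℂ] H)) : Set (H →L[ℂ] H) :=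
  {a | ∀ x ∈ I, a * x ∈ J}

/-- The sequence space `E_I` of an ideal `I`: the null sequences `ξ` such that `ξ*` is the sequence
of singular values of some `x ∈ I`. -/
def seqSpace (I : Ideal (H →L[ℂ] H)) : Set (ℕ → ℝ) :=
  {ξ | Tendsto ξ atTop (𝓝 0) ∧ ∃ x ∈ I, rearrangement ξ = singularValue x}

variable (H) in
/-- `C_E`: the compact operators on `H` whose sequence of singular values lies in `E`. -/
def operatorSpace (E : Set (ℕ → ℝ)) : Set (H →L[ℂ] H) :=
  {x | IsCompactOperator x ∧ singularValue x ∈ E}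

end

end QuasiBanachIdeals

namespace QuasiBanachIdeals

noncomputable section

open Filter Topology

/-! A two-sided ideal of compact operators is determined by its singular value sequences. By the
Schmidt decomposition (`exists_eq_schmidtOp`) every compact operator is a diagonal operator on `L2`
placed between isometries. Ideal membership can therefore be tested on diagonals, where domination
and reindexing are multiplications by bounded operators.

Let `a` lie in `J : I`. If `a` were not compact, the identity of `L2` would factor through it, and
every `x ∈ I` could be recovered from a product `a * x'` with `x' ∈ I`, giving `I ≤ J`. So `a` is
compact with Schmidt vectors `e`, `f`. For `η ∈ E_I` the operator with diagonal `η` along `e` is in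
`I`, and its product with `a` is in `J` and has diagonal `s(a) η`.

Conversely, let `x ∈ I` and let `s(a) s(x)` be the singular values of some `y ∈ J`. With indices
from `0`, `singularValue_mul_le` bounds term `2n` of `s(a x)` by term `n` of `s(y)`. The even and
the odd terms of `s(a x)` are then both dominated by `s(y)`, so `a x` is a sum of two elements of
`J` (`mem_of_singularValue_two_mul_le`). -/

/-! ### Sequences -/

/-- A sequence in which every term stands in a prescribed relation to the preceding ones. -/
theorem exists_seq_of_forall_finset {α : Type*} (P : Finset α → α → Prop)
    (h : ∀ s, ∃ y, P s y) : ∃ f : ℕ → α, ∀ n, ∃ s : Finset α, (s : Set α) = f '' Set.Iio n ∧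
      P s (f n) := by
  classical
  choose φ hφ using h
  obtain ⟨S, hS0, hS1⟩ : ∃ S : ℕ → Finset α, S 0 = ∅ ∧ ∀ n, S (n + 1) = insert (φ (S n)) (S n) :=
    ⟨fun n => Nat.rec ∅ (fun _ s => insert (φ s) s) n, rfl, fun _ => rfl⟩
  have hS : ∀ n, (S n : Set α) = (fun k => φ (S k)) '' Set.Iio n := by
    intro n
    induction n with
    | zero => simp [hS0]
    | succ n ih =>
      have : Set.Iio (n + 1) = insert n (Set.Iio n) := by
        ext k
        simp only [Set.mem_insert_iff, Set.mem_Iio]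
        omega
      rw [hS1, Finset.coe_insert, ih, this, Set.image_insert_eq]
  exact ⟨fun n => φ (S n), fun n => ⟨S n, hS n, hφ _⟩⟩

theorem finite_setOf_lt_abs {ξ : ℕ → ℝ} (hξ : Tendsto ξ atTop (𝓝 0)) {t : ℝ} (ht : 0 < t) :
    {k | t < |ξ k|}.Finite := by
  have h : ∀ᶠ k in cofinite, |ξ k| < t := by
    rw [Nat.cofinite_eq_atTop]
    have := hξ.abs
    rw [abs_zero] at this
    exact this.eventually_lt_const ht
  refine Set.Finite.subset (Filter.eventually_cofinite.1 h) fun k hk => ?_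
  simp only [Set.mem_ofPred_eq] at hk ⊢
  exact not_lt.2 hk.le

/-- Every null sequence can be enumerated in decreasing order, omitting at most some zeros. -/
theorem exists_injective_antitone {ξ : ℕ → ℝ} (hξ : Tendsto ξ atTop (𝓝 0)) :
    ∃ σ : ℕ → ℕ, Function.Injective σ ∧ Antitone (fun n => |ξ (σ n)|) ∧
      ∀ k ∉ Set.range σ, ξ k = 0 := by
  have step : ∀ s : Finset ℕ, ∃ y, y ∉ s ∧ ∀ k ∉ s, |ξ k| ≤ |ξ y| := by
    intro s
    by_cases h : ∀ k ∉ s, ξ k = 0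
    · obtain ⟨y, hy⟩ := Infinite.exists_notMem_finset s
      exact ⟨y, hy, fun k hk => by simp [h k hk]⟩
    · push Not at h
      obtain ⟨k₀, hk₀, h0⟩ := h
      have hpos : 0 < |ξ k₀| := abs_pos.2 h0
      -- Halving the threshold puts `k₀` itself into this finite set, so a maximum over the set is a
      -- maximum over the whole complement of `s`.
      have hfin : ({k | |ξ k₀| / 2 < |ξ k|} \ (s : Set ℕ)).Finite :=
        (finite_setOf_lt_abs hξ (half_pos hpos)).sdiff
      have hk₀' : k₀ ∈ {k | |ξ k₀| / 2 < |ξ k|} \ (s : Set ℕ) := by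
        refine ⟨?_, by simpa using hk₀⟩
        simpa using h0
      obtain ⟨y, hy, hmax⟩ := Set.exists_max_image _ (fun k => |ξ k|) hfin ⟨k₀, hk₀'⟩
      refine ⟨y, by simpa using hy.2, fun k hk => ?_⟩
      by_cases hk' : |ξ k₀| / 2 < |ξ k|
      · exact hmax k ⟨hk', by simpa using hk⟩
      · exact (not_lt.1 hk').trans hy.1.le
  obtain ⟨σ, hσ⟩ := exists_seq_of_forall_finset _ step
  have hne : ∀ m n, m < n → σ n ≠ σ m := by
    intro m n hmn he
    obtain ⟨s, hs, h1, -⟩ := hσ n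
    apply h1
    rw [← Finset.mem_coe, hs, he]
    exact ⟨m, hmn, rfl⟩
  have hinj : Function.Injective σ := by
    intro m n h
    rcases lt_trichotomy m n with h' | h' | h'
    · exact absurd h.symm (hne _ _ h')
    · exact h'
    · exact absurd h (hne _ _ h')
  have hle : ∀ n k, k ∉ σ '' Set.Iio n → |ξ k| ≤ |ξ (σ n)| := by
    intro n k hk
    obtain ⟨s, hs, -, h2⟩ := hσ n
    exact h2 k (by rwa [← Finset.mem_coe, hs])
  refine ⟨σ, hinj, fun m n hmn => hle m _ ?_, fun k hk => ?_⟩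
  · rintro ⟨j, hj, he⟩
    have := hinj he
    simp only [Set.mem_Iio] at hj
    omega
  · have h1 : Tendsto (fun n => |ξ (σ n)|) atTop (𝓝 0) := by
      have := (hξ.comp (Nat.cofinite_eq_atTop ▸ hinj.tendsto_cofinite)).abs
      simpa using this
    have h2 : |ξ k| ≤ 0 := ge_of_tendsto' h1 fun n => hle n k fun ⟨j, _, h⟩ => hk ⟨j, h⟩
    exact abs_nonpos_iff.1 h2

/-- Only thresholds `t > 0` are counted, so the omitted zeros never contribute. -/
theorem rearrangement_comp {ξ : ℕ → ℝ} {σ : ℕ → ℕ} (hσ : Function.Injective σ)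
    (h0 : ∀ k ∉ Set.range σ, ξ k = 0) :
    rearrangement ξ = rearrangement fun n => |ξ (σ n)| := by
  funext n
  unfold rearrangement
  congr 1
  ext t
  refine and_congr_right fun ht => ?_
  have : {k : ℕ | t < |ξ k|} = σ '' {k | t < |(|ξ (σ k)|)|} := by
    ext k
    simp only [abs_abs, Set.mem_ofPred_eq, Set.mem_image]
    constructor
    · intro hk
      by_cases hr : k ∈ Set.range σ
      · obtain ⟨m, rfl⟩ := hr
        exact ⟨m, hk, rfl⟩
      · rw [h0 k hr, abs_zero] at hk
        exact absurd hk ht.not_gt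
    · rintro ⟨m, hm, rfl⟩
      exact hm
  rw [this, hσ.encard_image]

theorem rearrangement_eq_self {ξ : ℕ → ℝ} (hξ : Antitone ξ) (h0 : ∀ n, 0 ≤ ξ n) :
    rearrangement ξ = ξ := by
  funext n
  have key : {t : ℝ | 0 < t ∧ {k : ℕ | t < |ξ k|}.encard ≤ n} = {t | 0 < t ∧ ξ n ≤ t} := by
    ext t
    refine and_congr_right fun _ => ?_
    simp only [abs_of_nonneg (h0 _)]
    constructor
    · intro h
      by_contra! hlt
      have : Set.Iio (n + 1) ⊆ {k : ℕ | t < ξ k} := fun k hk =>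
        hlt.trans_le (hξ (Nat.lt_succ_iff.1 hk))
      have h2 := (Set.encard_le_encard this).trans h
      rw [← Finset.coe_Iio, Set.encard_coe_eq_coe_finsetCard, Nat.card_Iio] at h2
      have := ENat.natCast_le_natCast.1 h2
      omega
    · intro h
      have : {k : ℕ | t < ξ k} ⊆ Set.Iio n := fun k hk => by
        by_contra hkn
        exact absurd (hξ (not_lt.1 hkn)) (not_le.2 (h.trans_lt hk))
      refine (Set.encard_le_encard this).trans ?_
      rw [← Finset.coe_Iio, Set.encard_coe_eq_coe_finsetCard, Nat.card_Iio]
  rw [rearrangement, key]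
  -- At a zero term the condition `0 < t` makes the ray open; the infimum is the same but is not
  -- attained.
  rcases (h0 n).eq_or_lt with h | h
  · rw [← h]
    have : {t : ℝ | 0 < t ∧ 0 ≤ t} = Set.Ioi 0 := by
      ext t
      exact ⟨fun h => h.1, fun h => ⟨h, le_of_lt h⟩⟩
    rw [this, csInf_Ioi]
  · have : {t : ℝ | 0 < t ∧ ξ n ≤ t} = Set.Ici (ξ n) := by
      ext t
      exact ⟨fun h => h.2, fun h' => ⟨h.trans_le h', h'⟩⟩
    rw [this, csInf_Ici]

/-! ### Diagonal operators -/

/-- The Hilbert space of square-summable complex sequences. -/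
abbrev L2 := lp (fun _ : ℕ => ℂ) 2

/-- The sequence `s` is bounded. -/
def SeqBounded (s : ℕ → ℝ) : Prop := ∃ C, ∀ n, |s n| ≤ C

theorem SeqBounded.of_tendsto {s : ℕ → ℝ} (h : Tendsto s atTop (𝓝 0)) : SeqBounded s := by
  obtain ⟨C, hC⟩ := h.abs.bddAbove_range
  exact ⟨C, fun n => hC ⟨n, rfl⟩⟩

theorem SeqBounded.abs {s : ℕ → ℝ} (h : SeqBounded s) : SeqBounded fun n => |s n| := by
  obtain ⟨C, hC⟩ := h
  exact ⟨C, fun n => by simpa using hC n⟩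

theorem SeqBounded.mul {s t : ℕ → ℝ} (hs : SeqBounded s) (ht : SeqBounded t) :
    SeqBounded (s * t) := by
  obtain ⟨C, hC⟩ := hs
  obtain ⟨D, hD⟩ := ht
  refine ⟨C * D, fun n => ?_⟩
  rw [Pi.mul_apply, abs_mul]
  exact mul_le_mul (hC n) (hD n) (abs_nonneg _) ((abs_nonneg _).trans (hC n))

theorem SeqBounded.comp {s : ℕ → ℝ} (hs : SeqBounded s) (σ : ℕ → ℕ) : SeqBounded (s ∘ σ) := by
  obtain ⟨C, hC⟩ := hs
  exact ⟨C, fun n => hC _⟩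

theorem memℓp_mul {s : ℕ → ℝ} {C : ℝ} (hC : ∀ n, |s n| ≤ C) (v : L2) :
    Memℓp (fun n => (s n : ℂ) * v n) 2 := by
  have h1 := (C • v).2.summable (by norm_num)
  refine memℓp_gen (Summable.of_nonneg_of_le (fun n => by positivity) (fun n => ?_) h1)
  refine Real.rpow_le_rpow (norm_nonneg _) ?_ (by norm_num)
  rw [lp.coeFn_smul, Pi.smul_apply, norm_smul, norm_mul, Complex.norm_real, Real.norm_eq_abs,
    Real.norm_eq_abs]
  exact mul_le_mul_of_nonneg_right ((hC n).trans (le_abs_self C)) (norm_nonneg _)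

open Classical in
/-- The diagonal operator on `L2` with the bounded sequence `s` on its diagonal. -/
def diag (s : ℕ → ℝ) : L2 →L[ℂ] L2 :=
  if hs : SeqBounded s then
    LinearMap.mkContinuousOfExistsBound
      { toFun := fun v => ⟨fun n => (s n : ℂ) * v n, memℓp_mul hs.choose_spec v⟩
        map_add' := fun v w => by
          ext n
          exact mul_add _ _ _
        map_smul' := fun c v => by
          ext n
          simp [mul_left_comm] }
      ⟨|hs.choose|, fun v => by
        have h := lp.norm_mono (p := 2) (by norm_num)
          (x := (⟨fun n => (s n : ℂ) * v n, memℓp_mul hs.choose_spec v⟩ : L2))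
          (y := (hs.choose • v : L2)) fun n => by
            rw [lp.coeFn_smul, Pi.smul_apply, norm_smul, Real.norm_eq_abs]
            show ‖(s n : ℂ) * v n‖ ≤ _
            rw [norm_mul, Complex.norm_real, Real.norm_eq_abs]
            exact mul_le_mul_of_nonneg_right ((hs.choose_spec n).trans (le_abs_self _))
              (norm_nonneg _)
        rw [norm_smul, Real.norm_eq_abs] at h
        exact h⟩
  -- Default for unbounded sequences; the formulas for the entries assume `SeqBounded`.
  else 0

theorem diag_apply {s : ℕ → ℝ} (hs : SeqBounded s) (v : L2) (n : ℕ) :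
    diag s v n = s n * v n := by
  rw [diag, dif_pos hs]
  rfl

theorem diag_single {s : ℕ → ℝ} (hs : SeqBounded s) (n : ℕ) (c : ℂ) :
    diag s (lp.single 2 n c) = (s n : ℂ) • lp.single 2 n c := by
  ext k
  rw [diag_apply hs, lp.coeFn_smul, Pi.smul_apply, smul_eq_mul]
  by_cases h : k = n
  · subst h
    rfl
  · simp [h]

theorem diag_comp_diag {s t : ℕ → ℝ} (hs : SeqBounded s) (ht : SeqBounded t) :
    diag s ∘L diag t = diag (s * t) := by
  ext v n
  simp [diag_apply hs, diag_apply ht, diag_apply (hs.mul ht), mul_assoc]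

theorem adjoint_diag {s : ℕ → ℝ} (hs : SeqBounded s) :
    ContinuousLinearMap.adjoint (diag s) = diag s := by
  symm
  rw [ContinuousLinearMap.eq_adjoint_iff]
  intro v w
  rw [lp.inner_eq_tsum, lp.inner_eq_tsum]
  refine tsum_congr fun n => ?_
  simp [diag_apply hs]
  ring

theorem continuousLinearMap_ext_single {E : Type*} [NormedAddCommGroup E] [NormedSpace ℂ E]
    {A B : L2 →L[ℂ] E} (h : ∀ n, A (lp.single 2 n 1) = B (lp.single 2 n 1)) : A = B := by
  refine lp.ext_continuousLinearMap (by norm_num) fun n => ?_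
  ext
  simpa using h n

/-! ### Isometries given by orthonormal sequences -/

section Isometry

variable {E : Type*} [NormedAddCommGroup E] [InnerProductSpace ℂ E] [CompleteSpace E]

/-- The isometry that maps the standard orthonormal basis of `L2` to the orthonormal
sequence `e`. -/
def isom {e : ℕ → E} (he : Orthonormal ℂ e) : L2 →L[ℂ] E :=
  he.orthogonalFamily.linearIsometry.toContinuousLinearMap

theorem isom_single {e : ℕ → E} (he : Orthonormal ℂ e) (n : ℕ) :
    isom he (lp.single 2 n 1) = e n := by
  simp [isom]

theorem norm_isom {e : ℕ → E} (he : Orthonormal ℂ e) (v : L2) : ‖isom he v‖ = ‖v‖ :=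
  he.orthogonalFamily.linearIsometry.norm_map v

theorem adjoint_isom_comp_isom {e : ℕ → E} (he : Orthonormal ℂ e) :
    ContinuousLinearMap.adjoint (isom he) ∘L isom he = ContinuousLinearMap.id ℂ L2 :=
  (ContinuousLinearMap.norm_map_iff_adjoint_comp_self _).1 (norm_isom he)

theorem adjoint_isom_isom {e : ℕ → E} (he : Orthonormal ℂ e) (v : L2) :
    ContinuousLinearMap.adjoint (isom he) (isom he v) = v :=
  DFunLike.congr_fun (adjoint_isom_comp_isom he) v

theorem adjoint_isom_self {e : ℕ → E} (he : Orthonormal ℂ e) (n : ℕ) :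
    ContinuousLinearMap.adjoint (isom he) (e n) = lp.single 2 n 1 := by
  rw [← isom_single he, adjoint_isom_isom]

theorem adjoint_isom_apply {e : ℕ → E} (he : Orthonormal ℂ e) (v : E) (n : ℕ) :
    ContinuousLinearMap.adjoint (isom he) v n = inner ℂ (e n) v := by
  rw [← isom_single he n, ← ContinuousLinearMap.adjoint_inner_right, lp.inner_single_left]
  simp

theorem adjoint_isom_eq_zero {e : ℕ → E} (he : Orthonormal ℂ e) {v : E}
    (hv : ∀ n, inner ℂ (e n) v = 0) : ContinuousLinearMap.adjoint (isom he) v = 0 := by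
  ext n
  rw [adjoint_isom_apply, hv]
  rfl

theorem norm_adjoint_isom_le {e : ℕ → E} (he : Orthonormal ℂ e) (v : E) :
    ‖ContinuousLinearMap.adjoint (isom he) v‖ ≤ ‖v‖ := by
  refine (ContinuousLinearMap.le_opNorm _ _).trans ?_
  rw [LinearIsometryEquiv.norm_map]
  refine mul_le_of_le_one_left (norm_nonneg _) ?_
  exact ContinuousLinearMap.opNorm_le_bound _ zero_le_one fun w => by rw [norm_isom, one_mul]

theorem orthonormal_single : Orthonormal ℂ fun n : ℕ => (lp.single 2 n 1 : L2) := by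
  classical
  rw [orthonormal_iff_ite]
  intro i j
  rw [lp.inner_single_left, lp.single_apply]
  by_cases h : i = j
  · subst h; simp
  · simp [h]

/-- The isometry of `L2` that moves the `n`-th basis vector to the `σ n`-th one. -/
def reindex {σ : ℕ → ℕ} (hσ : Function.Injective σ) : L2 →L[ℂ] L2 :=
  isom (orthonormal_single.comp σ hσ)

-- Conjugating by a reindexing puts `s ∘ σ` back in place and keeps `s` only on the range of `σ`.
-- This serves both for restoring omitted zeros and for splitting into even and odd terms.
open Classical in
theorem reindex_diag_single {s : ℕ → ℝ} (hs : SeqBounded s) {σ : ℕ → ℕ}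
    (hσ : Function.Injective σ) (k : ℕ) :
    reindex hσ (diag (s ∘ σ) (ContinuousLinearMap.adjoint (reindex hσ) (lp.single 2 k 1))) =
      if k ∈ Set.range σ then (s k : ℂ) • lp.single 2 k 1 else 0 := by
  split_ifs with h
  · obtain ⟨m, rfl⟩ := h
    have h1 : reindex hσ (lp.single 2 m 1) = lp.single 2 (σ m) 1 := isom_single _ m
    rw [← h1, reindex, adjoint_isom_isom, diag_single (hs.comp σ), map_smul]
    rfl
  · have : ContinuousLinearMap.adjoint (reindex hσ) (lp.single 2 k 1) = 0 := by
      refine adjoint_isom_eq_zero _ fun n => ?_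
      refine orthonormal_single.2 fun hn => h ⟨n, hn⟩
    rw [this, map_zero, map_zero]

end Isometry

/-! ### Operators given by a Schmidt decomposition -/

section Schmidt

variable {H : Type*} [NormedAddCommGroup H] [InnerProductSpace ℂ H] [CompleteSpace H]

/-- The operator `∑ n, s n ⟪e n, ·⟫ f n`, for orthonormal sequences `e` and `f`. -/
def schmidtOp {e f : ℕ → H} (he : Orthonormal ℂ e) (hf : Orthonormal ℂ f) (s : ℕ → ℝ) :
    H →L[ℂ] H :=
  isom hf ∘L diag s ∘L ContinuousLinearMap.adjoint (isom he)

theorem schmidtOp_apply {e f : ℕ → H} (he : Orthonormal ℂ e) (hf : Orthonormal ℂ f) (s : ℕ → ℝ)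
    (v : H) : schmidtOp he hf s v =
      isom hf (diag s (ContinuousLinearMap.adjoint (isom he) v)) := rfl

theorem schmidtOp_self {e f : ℕ → H} (he : Orthonormal ℂ e) (hf : Orthonormal ℂ f) {s : ℕ → ℝ}
    (hs : SeqBounded s) (n : ℕ) : schmidtOp he hf s (e n) = (s n : ℂ) • f n := by
  rw [schmidtOp_apply, adjoint_isom_self, diag_single hs, map_smul, isom_single]

theorem diag_eq_of_schmidtOp {e f : ℕ → H} (he : Orthonormal ℂ e) (hf : Orthonormal ℂ f)
    (s : ℕ → ℝ) : ContinuousLinearMap.adjoint (isom hf) ∘L schmidtOp he hf s ∘L isom he =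
      diag s := by
  ext v : 1
  simp only [ContinuousLinearMap.comp_apply, schmidtOp_apply, adjoint_isom_isom]

theorem adjoint_schmidtOp {e f : ℕ → H} (he : Orthonormal ℂ e) (hf : Orthonormal ℂ f) {s : ℕ → ℝ}
    (hs : SeqBounded s) :
    ContinuousLinearMap.adjoint (schmidtOp he hf s) = schmidtOp hf he s := by
  simp only [schmidtOp, ContinuousLinearMap.adjoint_comp, adjoint_diag hs,
    ContinuousLinearMap.adjoint_adjoint, ContinuousLinearMap.comp_assoc]

theorem schmidtOp_comp_schmidtOp {e f g : ℕ → H} (he : Orthonormal ℂ e) (hf : Orthonormal ℂ f)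
    (hg : Orthonormal ℂ g) {s t : ℕ → ℝ} (hs : SeqBounded s) (ht : SeqBounded t) :
    schmidtOp hf hg s ∘L schmidtOp he hf t = schmidtOp he hg (s * t) := by
  ext v
  simp only [ContinuousLinearMap.comp_apply, schmidtOp_apply, adjoint_isom_isom,
    ← diag_comp_diag hs ht]

theorem schmidtOp_nonneg {e : ℕ → H} (he : Orthonormal ℂ e) {s : ℕ → ℝ}
    (hs : SeqBounded s) (h0 : ∀ n, 0 ≤ s n) : 0 ≤ schmidtOp he he s := by
  have hr : SeqBounded fun n => √(s n) := by
    obtain ⟨C, hC⟩ := hs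
    refine ⟨√C, fun n => ?_⟩
    rw [abs_of_nonneg (Real.sqrt_nonneg _)]
    exact Real.sqrt_le_sqrt ((le_abs_self _).trans (hC n))
  have h1 : schmidtOp he he s = ContinuousLinearMap.adjoint (schmidtOp he he fun n => √(s n)) ∘L
      schmidtOp he he fun n => √(s n) := by
    rw [adjoint_schmidtOp he he hr, schmidtOp_comp_schmidtOp he he he hr hr]
    congr 1
    funext n
    exact (Real.mul_self_sqrt (h0 n)).symm
  rw [ContinuousLinearMap.nonneg_iff_isPositive, h1]
  exact ContinuousLinearMap.isPositive_adjoint_comp_self _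

/-- In `x* x` the vectors `f` cancel and the diagonal is squared; uniqueness of the positive square
root does the rest. -/
theorem abs_schmidtOp {e f : ℕ → H} (he : Orthonormal ℂ e) (hf : Orthonormal ℂ f) {s : ℕ → ℝ}
    (hs : SeqBounded s) : CFC.abs (schmidtOp he hf s) = schmidtOp he he fun n => |s n| := by
  refine CFC.sqrt_unique ?_ (schmidtOp_nonneg he hs.abs fun n => abs_nonneg _)
  rw [ContinuousLinearMap.star_eq_adjoint, adjoint_schmidtOp he hf hs]
  refine (schmidtOp_comp_schmidtOp he he he hs.abs hs.abs).trans
    (Eq.trans ?_ (schmidtOp_comp_schmidtOp he hf he hs hs).symm)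
  congr 1
  funext n
  exact abs_mul_abs_self _

theorem isom_eq_sum {e : ℕ → H} (he : Orthonormal ℂ e) (A : Finset ℕ) (c : L2)
    (hc : ∀ k ∉ A, c k = 0) : isom he c = ∑ k ∈ A, c k • e k := by
  have : c = ∑ k ∈ A, c k • lp.single 2 k (1 : ℂ) := by
    ext n
    rw [lp.coeFn_sum, Finset.sum_apply]
    simp only [lp.coeFn_smul, Pi.smul_apply, lp.single_apply, smul_eq_mul]
    by_cases hn : n ∈ A
    · rw [Finset.sum_eq_single n]
      · simp
      · intro b _ hb
        simp [Ne.symm hb]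
      · exact fun h => absurd hn h
    · rw [hc n hn, Finset.sum_eq_zero]
      intro b hb
      have : n ≠ b := fun h => hn (h ▸ hb)
      simp [this]
  conv_lhs => rw [this]
  simp only [map_sum, map_smul, isom_single]

/-- An eigenvector for `μ > t > 0` lies in the range of `|x|`, hence of `isom he`, and its
coordinates are supported where `|s k| = μ`. Positivity of `t` excludes the kernel, and the null
limit makes the support finite. -/
theorem eigenspaceAbove_schmidtOp {e f : ℕ → H} (he : Orthonormal ℂ e) (hf : Orthonormal ℂ f)
    {s : ℕ → ℝ} (hs : Tendsto s atTop (𝓝 0)) {t : ℝ} (ht : 0 < t) :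
    eigenspaceAbove (schmidtOp he hf s) t = Submodule.span ℂ (e '' {k | t < |s k|}) := by
  have hb := SeqBounded.of_tendsto hs
  unfold eigenspaceAbove
  rw [abs_schmidtOp he hf hb]
  apply le_antisymm
  · refine iSup_le fun ⟨μ, hμ⟩ v hv => ?_
    rw [Module.End.mem_eigenspace_iff, ContinuousLinearMap.coe_coe] at hv
    set c := ContinuousLinearMap.adjoint (isom he) v with hc
    have hμ0 : (μ : ℂ) ≠ 0 := by exact_mod_cast (ht.trans hμ).ne'
    have hD : diag (fun n => |s n|) c = (μ : ℂ) • c := by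
      rw [hc, ← map_smul, ← hv, schmidtOp_apply, adjoint_isom_isom]
    have hv' : v = isom he c := by
      have : (μ : ℂ) • v = (μ : ℂ) • isom he c := by
        rw [← hv, schmidtOp_apply, ← hc, hD, map_smul]
      exact smul_right_injective _ hμ0 this
    rw [hv', isom_eq_sum he (finite_setOf_lt_abs hs ht).toFinset c]
    · refine Submodule.sum_mem _ fun k hk => Submodule.smul_mem _ _ (Submodule.subset_span ?_)
      exact ⟨k, by simpa using hk, rfl⟩
    · intro k hk
      by_contra h0
      apply hk
      have := congrArg (fun w : L2 => w k) hD
      simp only [diag_apply hb.abs, lp.coeFn_smul, Pi.smul_apply, smul_eq_mul] at this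
      have := mul_right_cancel₀ h0 this
      have : |s k| = μ := Complex.ofReal_injective this
      simpa [this] using hμ
  · rw [Submodule.span_le]
    rintro _ ⟨k, hk, rfl⟩
    refine Submodule.mem_iSup_of_mem ⟨|s k|, hk⟩ ?_
    rw [Module.End.mem_eigenspace_iff, ContinuousLinearMap.coe_coe, schmidtOp_self he he hb.abs]

/-- Orthonormal vectors are independent, so rank and cardinality count the same thing. Neither sign
nor monotonicity of `s` matters, which allows the diagonal `s(a) η` later. -/
theorem singularValue_schmidtOp {e f : ℕ → H} (he : Orthonormal ℂ e) (hf : Orthonormal ℂ f)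
    {s : ℕ → ℝ} (hs : Tendsto s atTop (𝓝 0)) :
    singularValue (schmidtOp he hf s) = rearrangement s := by
  classical
  funext n
  unfold singularValue rearrangement
  congr 1
  ext t
  refine and_congr_right fun ht => ?_
  rw [eigenspaceAbove_schmidtOp he hf hs ht]
  obtain ⟨A, hA⟩ := (finite_setOf_lt_abs hs ht).exists_finset_coe
  rw [← hA, rank_span_set (he.linearIndependent.linearIndepOn A).id_image,
    Set.encard_coe_eq_coe_finsetCard, ← Finset.coe_image]
  erw [Cardinal.mk_coe_finset]
  rw [Finset.card_image_of_injective _ he.linearIndependent.injective]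
  simp

end Schmidt

section SchmidtDecomposition

variable {H : Type*} [NormedAddCommGroup H] [InnerProductSpace ℂ H]

/-! ### Orthonormal sequences -/

theorem orthonormal_of_lt {e : ℕ → H} (h1 : ∀ n, ‖e n‖ = 1)
    (h2 : ∀ m n, m < n → inner ℂ (e m) (e n) = 0) : Orthonormal ℂ e := by
  refine ⟨h1, fun m n hmn => ?_⟩
  rcases lt_or_gt_of_ne hmn with h | h
  · exact h2 m n h
  · exact inner_eq_zero_symm.1 (h2 n m h)

theorem orthonormal_normalize {y : ℕ → H} (h0 : ∀ n, y n ≠ 0)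
    (h : ∀ m n, m < n → inner ℂ (y m) (y n) = 0) :
    Orthonormal ℂ fun n => ((‖y n‖⁻¹ : ℝ) : ℂ) • y n := by
  refine orthonormal_of_lt (fun n => ?_) fun m n hmn => ?_
  · rw [norm_smul, Complex.norm_real, norm_inv, norm_norm,
      inv_mul_cancel₀ (norm_ne_zero_iff.2 (h0 n))]
  · rw [inner_smul_left, inner_smul_right, h m n hmn, mul_zero, mul_zero]

theorem norm_smul_normalize (v : H) : v = ((‖v‖ : ℝ) : ℂ) • ((‖v‖⁻¹ : ℝ) : ℂ) • v := by
  rcases eq_or_ne v 0 with rfl | h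
  · simp
  · rw [smul_smul, ← Complex.ofReal_mul, mul_inv_cancel₀ (norm_ne_zero_iff.2 h)]
    simp

theorem exists_unit_mem_orthogonal (hH : ¬ FiniteDimensional ℂ H) (F : Submodule ℂ H)
    [FiniteDimensional ℂ F] : ∃ v ∈ Fᗮ, ‖v‖ = 1 := by
  have hF : Fᗮ ≠ ⊥ := by
    intro h
    rw [Submodule.orthogonal_eq_bot_iff] at h
    subst h
    exact hH (Module.Finite.equiv (Submodule.topEquiv (R := ℂ) (M := H)))
  obtain ⟨v, hv, h0⟩ := Submodule.exists_mem_ne_zero_of_ne_bot hF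
  refine ⟨((‖v‖⁻¹ : ℝ) : ℂ) • v, Submodule.smul_mem _ _ hv, ?_⟩
  rw [norm_smul, Complex.norm_real, norm_inv, norm_norm, inv_mul_cancel₀ (norm_ne_zero_iff.2 h0)]

theorem exists_orthonormal_mem_orthogonal (hH : ¬ FiniteDimensional ℂ H) (F : Submodule ℂ H)
    [FiniteDimensional ℂ F] : ∃ g : ℕ → H, Orthonormal ℂ g ∧ ∀ n, g n ∈ Fᗮ := by
  obtain ⟨g, hg⟩ := exists_seq_of_forall_finset
    (fun s v => v ∈ (F ⊔ Submodule.span ℂ (s : Set H))ᗮ ∧ ‖v‖ = 1)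
    fun s => exists_unit_mem_orthogonal hH _
  refine ⟨g, orthonormal_of_lt (fun n => ?_) fun m n hmn => ?_, fun n => ?_⟩
  · obtain ⟨s, -, -, h⟩ := hg n
    exact h
  · obtain ⟨s, hs, h, -⟩ := hg n
    refine h _ (Submodule.mem_sup_right (Submodule.subset_span ?_))
    rw [hs]
    exact ⟨m, hmn, rfl⟩
  · obtain ⟨s, -, h, -⟩ := hg n
    exact Submodule.orthogonal_le le_sup_left h

/-- By monotonicity the sequence is zero from its first zero on, so only a finite head needs
normalizing. The tail is filled with any orthonormal sequence orthogonal to that head. -/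
theorem exists_orthonormal_norm_smul (hH : ¬ FiniteDimensional ℂ H) {y : ℕ → H}
    (h : ∀ m n, m < n → inner ℂ (y m) (y n) = 0) (hy : Antitone fun n => ‖y n‖) :
    ∃ f : ℕ → H, Orthonormal ℂ f ∧ ∀ n, y n = ((‖y n‖ : ℝ) : ℂ) • f n := by
  classical
  by_cases h0 : ∀ n, y n ≠ 0
  · exact ⟨_, orthonormal_normalize h0 h, fun n => norm_smul_normalize _⟩
  · push Not at h0
    have hN : ∀ n, Nat.find h0 ≤ n → y n = 0 := fun n hn => by
      have := hy hn
      simp only [Nat.find_spec h0, norm_zero] at this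
      exact norm_le_zero_iff.1 this
    set N := Nat.find h0 with hNdef
    have hlt : ∀ n, n < N → y n ≠ 0 := fun n hn => Nat.find_min h0 hn
    have hfin : FiniteDimensional ℂ (Submodule.span ℂ (y '' Set.Iio N)) :=
      FiniteDimensional.span_of_finite ℂ ((Set.finite_Iio N).image y)
    obtain ⟨g, hg, hgF⟩ := exists_orthonormal_mem_orthogonal hH
      (Submodule.span ℂ (y '' Set.Iio N))
    refine ⟨fun n => if n < N then ((‖y n‖⁻¹ : ℝ) : ℂ) • y n else g n,
      orthonormal_of_lt (fun n => ?_) fun m n hmn => ?_, fun n => ?_⟩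
    · split_ifs with hn
      · rw [norm_smul, Complex.norm_real, norm_inv, norm_norm,
          inv_mul_cancel₀ (norm_ne_zero_iff.2 (hlt n hn))]
      · exact hg.1 n
    · by_cases hn : n < N
      · rw [if_pos (hmn.trans hn), if_pos hn, inner_smul_left, inner_smul_right, h m n hmn,
          mul_zero, mul_zero]
      · rw [if_neg hn]
        split_ifs with hm
        · rw [inner_smul_left, hgF n _ (Submodule.subset_span ⟨m, hm, rfl⟩), mul_zero]
        · exact hg.2 hmn.ne
    · beta_reduce
      split_ifs with hn
      · exact norm_smul_normalize _
      · rw [hN n (not_lt.1 hn)]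
        simp

/-! ### Existence of Schmidt decompositions -/

/-- Orthogonal images of norm at least `δ` stay at distance at least `δ`, so no subsequence
converges. -/
theorem not_forall_le_norm_of_isCompactOperator {x : H →L[ℂ] H} (hx : IsCompactOperator x)
    {e : ℕ → H} (he : ∀ n, ‖e n‖ = 1) (ho : ∀ m n, m < n → inner ℂ (x (e m)) (x (e n)) = 0)
    {δ : ℝ} (hδ : 0 < δ) : ¬ ∀ n, δ ≤ ‖x (e n)‖ := by
  intro h
  have hc := hx.isCompact_closure_image_closedBall (𝕜₁ := ℂ) 1
  obtain ⟨w, -, φ, hφ, hlim⟩ := hc.tendsto_subseq (x := fun n => x (e n))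
    fun n => subset_closure ⟨e n, by simp [he n], rfl⟩
  have hcau := hlim.cauchySeq
  obtain ⟨N, hN⟩ := Metric.cauchySeq_iff.1 hcau δ hδ
  have h1 := hN N le_rfl (N + 1) (Nat.le_succ N)
  have h2 := ho _ _ (hφ (Nat.lt_succ_self N))
  simp only [Function.comp_apply, dist_eq_norm] at h1
  have h3 := norm_sub_sq (𝕜 := ℂ) (x (e (φ N))) (x (e (φ (N + 1))))
  rw [h2, map_zero, mul_zero, sub_zero] at h3
  have h4 := mul_self_le_mul_self hδ.le (h (φ N))
  have h5 := mul_self_lt_mul_self (norm_nonneg _) h1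
  nlinarith [sq_nonneg ‖x (e (φ (N + 1)))‖]

variable [CompleteSpace H]

/-- A compact operator attains its norm at a unit eigenvector of `x* x`. -/
theorem exists_unit_eigenvector {x : H →L[ℂ] H} (hx : IsCompactOperator x) (h0 : x ≠ 0) :
    ∃ v, ‖v‖ = 1 ∧ ContinuousLinearMap.adjoint x (x v) = ((‖x‖ * ‖x‖ : ℝ) : ℂ) • v := by
  set T : H →L[ℂ] H := ContinuousLinearMap.adjoint x ∘L x with hT
  have hTn : ‖T‖ = ‖x‖ * ‖x‖ := ContinuousLinearMap.norm_adjoint_comp_self x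
  have hTpos : 0 ≤ T := by
    rw [ContinuousLinearMap.nonneg_iff_isPositive]
    exact ContinuousLinearMap.isPositive_adjoint_comp_self _
  have hTc : IsCompactOperator T := hx.clm_comp (ContinuousLinearMap.adjoint x)
  have hx0 : ‖x‖ ≠ 0 := norm_ne_zero_iff.2 h0
  have : Nontrivial (H →L[ℂ] H) := ⟨x, 0, h0⟩
  -- A positive operator has its norm in the spectrum, and nonzero spectral values of a compact
  -- operator are eigenvalues.
  have hmem : ((‖T‖ : ℝ) : ℂ) ∈ spectrum ℂ T :=
    spectrum.algebraMap_mem ℂ (CStarAlgebra.norm_mem_spectrum_of_nonneg hTpos)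
  have hne : ((‖T‖ : ℝ) : ℂ) ≠ 0 := by
    rw [hTn]
    exact_mod_cast mul_ne_zero hx0 hx0
  obtain ⟨v, hv⟩ := ((hTc.hasEigenvalue_iff_mem_spectrum hne).2 hmem).exists_hasEigenvector
  have hv' : T v = ((‖T‖ : ℝ) : ℂ) • v := hv.apply_eq_smul
  refine ⟨((‖v‖⁻¹ : ℝ) : ℂ) • v, ?_, ?_⟩
  · rw [norm_smul, Complex.norm_real, norm_inv, norm_norm,
      inv_mul_cancel₀ (norm_ne_zero_iff.2 hv.2)]
  · rw [map_smul, map_smul, smul_comm, ← hTn, ← hv']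
    rfl

/-- One greedy step of the Schmidt decomposition: a top eigenvector of `y* y` for `y = x P`, with
`P` the projection onto `Fᗮ`. Its eigenvalue is nonzero unless `y = 0`, which forces it into the
range of `P`; the eigenvalue equation carries orthogonality to the images. -/
theorem exists_unit_maximal (hH : ¬ FiniteDimensional ℂ H) {x : H →L[ℂ] H}
    (hx : IsCompactOperator x) (F : Submodule ℂ H) [FiniteDimensional ℂ F] :
    ∃ v ∈ Fᗮ, ‖v‖ = 1 ∧ (∀ w ∈ Fᗮ, ‖x w‖ ≤ ‖x v‖ * ‖w‖) ∧
      ∀ w ∈ Fᗮ, inner ℂ v w = 0 → inner ℂ (x v) (x w) = 0 := by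
  set P := Fᗮ.starProjection with hP
  set y := x ∘L P with hy
  have hyx : ∀ w ∈ Fᗮ, y w = x w := fun w hw => by
    rw [hy, ContinuousLinearMap.comp_apply, hP, Submodule.starProjection_eq_self_iff.2 hw]
  by_cases h0 : y = 0
  · obtain ⟨v, hv, hv1⟩ := exists_unit_mem_orthogonal hH F
    have hz : ∀ w ∈ Fᗮ, x w = 0 := fun w hw => by rw [← hyx w hw, h0]; rfl
    refine ⟨v, hv, hv1, fun w hw => ?_, fun w hw _ => ?_⟩
    · rw [hz w hw, hz v hv]; simp
    · rw [hz w hw, inner_zero_right]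
  · obtain ⟨v, hv1, hv⟩ := exists_unit_eigenvector (hx.comp_clm P : IsCompactOperator y) h0
    have hM : ((‖y‖ * ‖y‖ : ℝ) : ℂ) ≠ 0 := by
      have := norm_ne_zero_iff.2 h0
      exact_mod_cast mul_ne_zero this this
    have hPadj : ContinuousLinearMap.adjoint P = P :=
      (isSelfAdjoint_starProjection Fᗮ).adjoint_eq
    have hvF : v ∈ Fᗮ := by
      have : v = ((‖y‖ * ‖y‖ : ℝ) : ℂ)⁻¹ • P (ContinuousLinearMap.adjoint x (y v)) := by
        rw [hy, ContinuousLinearMap.adjoint_comp, hPadj, ContinuousLinearMap.comp_apply, ← hy] at hv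
        rw [hv, inv_smul_smul₀ hM]
      rw [this]
      exact Submodule.smul_mem _ _ (Submodule.starProjection_apply_mem _ _)
    have hin : ∀ w, inner ℂ (y v) (y w) = ((‖y‖ * ‖y‖ : ℝ) : ℂ) * inner ℂ v w := fun w => by
      rw [← ContinuousLinearMap.adjoint_inner_left, hv, inner_smul_left, Complex.conj_ofReal]
    have hnorm : ‖y v‖ = ‖y‖ := by
      have := hin v
      rw [inner_self_eq_norm_sq_to_K, inner_self_eq_norm_sq_to_K, hv1] at this
      have h2 : ‖y v‖ ^ 2 = ‖y‖ ^ 2 := by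
        have h3 : ((‖y v‖ ^ 2 : ℝ) : ℂ) = ((‖y‖ * ‖y‖ : ℝ) : ℂ) := by
          simpa using this
        rw [pow_two ‖y‖]
        exact Complex.ofReal_injective h3
      exact (pow_left_inj₀ (norm_nonneg _) (norm_nonneg _) two_ne_zero).1 h2
    refine ⟨v, hvF, hv1, fun w hw => ?_, fun w hw hvw => ?_⟩
    · rw [← hyx w hw, ← hyx v hvF, hnorm]
      exact y.le_opNorm w
    · rw [← hyx w hw, ← hyx v hvF, hin, hvw, mul_zero]

/-- Each `e n` maximizes `‖x v‖` among unit vectors orthogonal to its predecessors. The maxima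
decrease to `0` by compactness and bound `x` on the orthogonal complement of all `e n`, so `x`
vanishes there and `H` need not be separable. -/
theorem exists_eq_schmidtOp (hH : ¬ FiniteDimensional ℂ H) {x : H →L[ℂ] H}
    (hx : IsCompactOperator x) :
    ∃ (e f : ℕ → H) (he : Orthonormal ℂ e) (hf : Orthonormal ℂ f) (s : ℕ → ℝ),
      Antitone s ∧ (∀ n, 0 ≤ s n) ∧ Tendsto s atTop (𝓝 0) ∧ x = schmidtOp he hf s := by
  obtain ⟨e, he⟩ := exists_seq_of_forall_finset
    (fun (s : Finset H) v => v ∈ (Submodule.span ℂ (s : Set H))ᗮ ∧ ‖v‖ = 1 ∧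
      (∀ w ∈ (Submodule.span ℂ (s : Set H))ᗮ, ‖x w‖ ≤ ‖x v‖ * ‖w‖) ∧
      ∀ w ∈ (Submodule.span ℂ (s : Set H))ᗮ, inner ℂ v w = 0 → inner ℂ (x v) (x w) = 0)
    fun s => exists_unit_maximal hH hx _
  have hmem : ∀ n v, (∀ k < n, inner ℂ (e k) v = 0) →
      v ∈ (Submodule.span ℂ (e '' Set.Iio n))ᗮ := by
    intro n v hv
    rw [Submodule.mem_orthogonal]
    intro u hu
    induction hu using Submodule.span_induction with
    | mem u hu =>
      obtain ⟨k, hk, rfl⟩ := hu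
      exact hv k hk
    | zero => exact inner_zero_left _
    | add u u' _ _ h h' => rw [inner_add_left, h, h', add_zero]
    | smul c u _ h => rw [inner_smul_left, h, mul_zero]
  have hunit : ∀ n, ‖e n‖ = 1 := fun n => by
    obtain ⟨s, -, -, h, -⟩ := he n
    exact h
  have hlt : ∀ m n, m < n → inner ℂ (e m) (e n) = 0 := fun m n hmn => by
    obtain ⟨s, hs, h, -⟩ := he n
    refine h _ (Submodule.subset_span ?_)
    rw [hs]
    exact ⟨m, hmn, rfl⟩
  have heo : Orthonormal ℂ e := orthonormal_of_lt hunit hlt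
  have hmax : ∀ n v, (∀ k < n, inner ℂ (e k) v = 0) → ‖x v‖ ≤ ‖x (e n)‖ * ‖v‖ := by
    intro n v hv
    obtain ⟨s, hs, -, -, h, -⟩ := he n
    refine h v ?_
    rw [hs]
    exact hmem n v hv
  have hxo : ∀ m n, m < n → inner ℂ (x (e m)) (x (e n)) = 0 := by
    intro m n hmn
    obtain ⟨s, hs, -, -, -, h⟩ := he m
    refine h _ ?_ (hlt m n hmn)
    rw [hs]
    exact hmem m _ fun k hk => hlt k n (hk.trans hmn)
  have hanti : Antitone fun n => ‖x (e n)‖ := by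
    refine antitone_nat_of_succ_le fun n => ?_
    have := hmax n (e (n + 1)) fun k hk => hlt k (n + 1) (hk.trans (Nat.lt_succ_self n))
    rwa [hunit, mul_one] at this
  have hlim : Tendsto (fun n => ‖x (e n)‖) atTop (𝓝 0) := by
    rw [Metric.tendsto_atTop]
    intro δ hδ
    have := not_forall_le_norm_of_isCompactOperator hx hunit hxo hδ
    push Not at this
    obtain ⟨N, hN⟩ := this
    refine ⟨N, fun n hn => ?_⟩
    rw [Real.dist_eq, sub_zero, abs_of_nonneg (norm_nonneg _)]
    exact (hanti hn).trans_lt hN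
  obtain ⟨f, hf, hxf⟩ := exists_orthonormal_norm_smul hH hxo hanti
  refine ⟨e, f, heo, hf, fun n => ‖x (e n)‖, hanti, fun n => norm_nonneg _, hlim, ?_⟩
  have h1 : x ∘L isom heo = isom hf ∘L diag fun n => ‖x (e n)‖ := by
    refine continuousLinearMap_ext_single fun n => ?_
    rw [ContinuousLinearMap.comp_apply, ContinuousLinearMap.comp_apply,
      diag_single (SeqBounded.of_tendsto hlim), map_smul, isom_single, isom_single]
    exact hxf n
  ext v
  set c := ContinuousLinearMap.adjoint (isom heo) v with hc
  have h2 : x (v - isom heo c) = 0 := by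
    have h3 : ∀ n, ‖x (v - isom heo c)‖ ≤ ‖x (e n)‖ * ‖v - isom heo c‖ := fun n => by
      refine hmax n _ fun k _ => ?_
      rw [← adjoint_isom_apply heo, map_sub, adjoint_isom_isom, ← hc, sub_self]
      rfl
    have h4 := ge_of_tendsto' (hlim.mul_const ‖v - isom heo c‖) h3
    rw [zero_mul] at h4
    exact norm_le_zero_iff.1 h4
  rw [map_sub, sub_eq_zero] at h2
  rw [h2, schmidtOp_apply, ← hc]
  exact DFunLike.congr_fun h1 c

/-- The Schmidt decomposition of a compact operator. -/
theorem exists_eq_schmidtOp_singularValue (hH : ¬ FiniteDimensional ℂ H) {x : H →L[ℂ] H}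
    (hx : IsCompactOperator x) :
    Antitone (singularValue x) ∧ (∀ n, 0 ≤ singularValue x n) ∧
      Tendsto (singularValue x) atTop (𝓝 0) ∧
      ∃ (e f : ℕ → H) (he : Orthonormal ℂ e) (hf : Orthonormal ℂ f),
        x = schmidtOp he hf (singularValue x) := by
  obtain ⟨e, f, he, hf, s, h1, h2, h3, h4⟩ := exists_eq_schmidtOp hH hx
  have : singularValue x = s := by
    rw [h4, singularValue_schmidtOp he hf h3, rearrangement_eq_self h1 h2]
  rw [this]
  exact ⟨h1, h2, h3, e, f, he, hf, h4⟩

end SchmidtDecomposition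

section Noncompact

variable {H : Type*} [NormedAddCommGroup H] [InnerProductSpace ℂ H] [CompleteSpace H]

/-! ### Noncompact operators -/

/-- Otherwise the finite-rank operators `a P_F` would approximate `a` in norm, and compact operators
form a closed set. -/
theorem exists_le_norm_of_not_isCompactOperator {a : H →L[ℂ] H} (ha : ¬ IsCompactOperator a) :
    ∃ δ : ℝ, 0 < δ ∧ ∀ (F : Submodule ℂ H) [FiniteDimensional ℂ F],
      ∃ v ∈ Fᗮ, ‖v‖ = 1 ∧ δ ≤ ‖a v‖ := by
  by_contra! hcon
  apply ha
  refine isClosed_setOfPred_isCompactOperator.closure_subset (Metric.mem_closure_iff.2 fun ε hε => ?_)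
  obtain ⟨F, hF, h⟩ := hcon (ε / 2) (half_pos hε)
  have hc : IsCompactOperator (a ∘L F.starProjection) :=
    (isCompactOperator_of_locallyCompactSpace_rng (a ∘L F.subtypeL)).comp_clm
      F.orthogonalProjectionOnto
  refine ⟨a ∘L F.starProjection, hc, ?_⟩
  rw [dist_eq_norm]
  refine lt_of_le_of_lt ?_ (half_lt_self hε)
  refine ContinuousLinearMap.opNorm_le_bound _ (half_pos hε).le fun v => ?_
  rw [sub_apply, ContinuousLinearMap.comp_apply, ← map_sub]
  set w := v - F.starProjection v with hw
  have hwF : w ∈ Fᗮ := Submodule.sub_starProjection_mem_orthogonal v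
  have hwn : ‖w‖ ≤ ‖v‖ := by
    have h1 : w = Fᗮ.starProjection v := (Submodule.starProjection_orthogonal_val v).symm
    rw [h1]
    exact Submodule.norm_starProjection_apply_le _ v
  rcases eq_or_ne w 0 with h0 | h0
  · rw [h0, map_zero, norm_zero]
    exact mul_nonneg (half_pos hε).le (norm_nonneg _)
  · have h1 := h (((‖w‖⁻¹ : ℝ) : ℂ) • w) (Submodule.smul_mem _ _ hwF) (by
      rw [norm_smul, Complex.norm_real, norm_inv, norm_norm,
        inv_mul_cancel₀ (norm_ne_zero_iff.2 h0)])
    rw [map_smul, norm_smul, Complex.norm_real, norm_inv, norm_norm,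
      inv_mul_lt_iff₀ (norm_pos_iff.2 h0), mul_comm] at h1
    exact h1.le.trans (mul_le_mul_of_nonneg_left hwn (half_pos hε).le)

/-- The identity of `L2` factors through every noncompact operator. -/
theorem exists_comp_eq_id_of_not_isCompactOperator {a : H →L[ℂ] H} (ha : ¬ IsCompactOperator a) :
    ∃ (B : H →L[ℂ] L2) (C : L2 →L[ℂ] H), B ∘L a ∘L C = ContinuousLinearMap.id ℂ L2 := by
  classical
  obtain ⟨δ, hδ, h⟩ := exists_le_norm_of_not_isCompactOperator ha
  -- Avoiding the vectors `a* a u` as well as `u` makes the images `a (e n)` orthogonal too.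
  obtain ⟨e, he⟩ := exists_seq_of_forall_finset
    (fun (s : Finset H) v => v ∈ (Submodule.span ℂ
        ((s ∪ s.image fun u => ContinuousLinearMap.adjoint a (a u) : Finset H) : Set H))ᗮ ∧
      ‖v‖ = 1 ∧ δ ≤ ‖a v‖) fun s => h _
  have h1 : ∀ m n, m < n → inner ℂ (e m) (e n) = 0 := fun m n hmn => by
    obtain ⟨s, hs, hv, -⟩ := he n
    refine hv _ (Submodule.subset_span ?_)
    rw [Finset.coe_union, hs]
    exact Or.inl ⟨m, hmn, rfl⟩
  have h2 : ∀ m n, m < n → inner ℂ (a (e m)) (a (e n)) = 0 := fun m n hmn => by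
    obtain ⟨s, hs, hv, -⟩ := he n
    rw [← ContinuousLinearMap.adjoint_inner_left]
    refine hv _ (Submodule.subset_span ?_)
    rw [Finset.coe_union, Finset.coe_image, hs]
    exact Or.inr ⟨e m, ⟨m, hmn, rfl⟩, rfl⟩
  have h3 : ∀ n, δ ≤ ‖a (e n)‖ := fun n => by
    obtain ⟨s, -, -, -, h⟩ := he n
    exact h
  have heo : Orthonormal ℂ e := orthonormal_of_lt (fun n => by
    obtain ⟨s, -, -, h, -⟩ := he n
    exact h) h1
  have hpos : ∀ n, 0 < ‖a (e n)‖ := fun n => hδ.trans_le (h3 n)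
  have hfo := orthonormal_normalize (fun n => norm_pos_iff.1 (hpos n)) h2
  have hb : SeqBounded fun n => ‖a (e n)‖⁻¹ := ⟨δ⁻¹, fun n => by
    rw [abs_of_nonneg (inv_nonneg.2 (norm_nonneg _))]
    exact inv_anti₀ hδ (h3 n)⟩
  refine ⟨diag (fun n => ‖a (e n)‖⁻¹) ∘L ContinuousLinearMap.adjoint (isom hfo), isom heo,
    continuousLinearMap_ext_single fun n => ?_⟩
  simp only [ContinuousLinearMap.comp_apply, isom_single]
  rw [norm_smul_normalize (a (e n)), map_smul, adjoint_isom_self hfo n, map_smul, diag_single hb,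
    smul_smul, ← Complex.ofReal_mul, mul_inv_cancel₀ (hpos n).ne']
  simp

/-! ### Singular values of products -/

/-- This and `le_norm_schmidtOp_isom` are the two halves of the min-max principle. -/
theorem norm_schmidtOp_le {e f : ℕ → H} (he : Orthonormal ℂ e) (hf : Orthonormal ℂ f)
    {s : ℕ → ℝ} (hs : Antitone s) (h0 : ∀ n, 0 ≤ s n) {n : ℕ} {v : H}
    (hv : ∀ k < n, inner ℂ (e k) v = 0) : ‖schmidtOp he hf s v‖ ≤ s n * ‖v‖ := by
  have hb : SeqBounded s := ⟨s 0, fun n => by rw [abs_of_nonneg (h0 n)]; exact hs (Nat.zero_le n)⟩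
  rw [schmidtOp_apply, norm_isom]
  set c := ContinuousLinearMap.adjoint (isom he) v with hc
  have h1 : ‖diag s c‖ ≤ ‖s n • c‖ := by
    refine lp.norm_mono (by norm_num) fun k => ?_
    rw [diag_apply hb, lp.coeFn_smul, Pi.smul_apply, norm_smul, norm_mul, Complex.norm_real,
      Real.norm_eq_abs, Real.norm_eq_abs, abs_of_nonneg (h0 _), abs_of_nonneg (h0 _)]
    by_cases hk : k < n
    · rw [hc, adjoint_isom_apply, hv k hk]
      simp
    · exact mul_le_mul_of_nonneg_right (hs (not_lt.1 hk)) (norm_nonneg _)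
  refine h1.trans ?_
  rw [norm_smul, Real.norm_eq_abs, abs_of_nonneg (h0 n)]
  exact mul_le_mul_of_nonneg_left (norm_adjoint_isom_le he v) (h0 n)

theorem le_norm_schmidtOp_isom {e f : ℕ → H} (he : Orthonormal ℂ e) (hf : Orthonormal ℂ f)
    {s : ℕ → ℝ} (hs : Antitone s) (h0 : ∀ n, 0 ≤ s n) {n : ℕ} {c : L2}
    (hc : ∀ k, n < k → c k = 0) : s n * ‖c‖ ≤ ‖schmidtOp he hf s (isom he c)‖ := by
  have hb : SeqBounded s := ⟨s 0, fun n => by rw [abs_of_nonneg (h0 n)]; exact hs (Nat.zero_le n)⟩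
  rw [schmidtOp_apply, norm_isom, adjoint_isom_isom]
  have h1 : ‖s n • c‖ ≤ ‖diag s c‖ := by
    refine lp.norm_mono (by norm_num) fun k => ?_
    rw [diag_apply hb, lp.coeFn_smul, Pi.smul_apply, norm_smul, norm_mul, Complex.norm_real,
      Real.norm_eq_abs, Real.norm_eq_abs, abs_of_nonneg (h0 _), abs_of_nonneg (h0 _)]
    by_cases hk : n < k
    · rw [hc k hk]
      simp
    · exact mul_le_mul_of_nonneg_right (hs (not_lt.1 hk)) (norm_nonneg _)
  rwa [norm_smul, Real.norm_eq_abs, abs_of_nonneg (h0 n)] at h1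

/-- A nonzero finitely supported vector on which finitely many functionals vanish. -/
theorem exists_ne_zero_forall_eq_zero {n m : ℕ} (hnm : n < m) (φ : Fin n → L2 →ₗ[ℂ] ℂ) :
    ∃ c : L2, c ≠ 0 ∧ (∀ k, m ≤ k → c k = 0) ∧ ∀ i, φ i c = 0 := by
  let W : (Fin m → ℂ) →ₗ[ℂ] L2 :=
    Fintype.linearCombination ℂ fun k : Fin m => (lp.single 2 (k : ℕ) 1 : L2)
  have hW : Function.Injective W := by
    have := (orthonormal_single.comp _ (Fin.val_injective (n := m))).linearIndependent
    exact this.fintypeLinearCombination_injective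
  have hker := LinearMap.ker_ne_bot_of_finrank_lt (f := (LinearMap.pi φ).comp W) (by simpa)
  obtain ⟨y, hy, hy0⟩ := Submodule.exists_mem_ne_zero_of_ne_bot hker
  refine ⟨W y, fun h => hy0 (hW (by rw [h, map_zero])), fun k hk => ?_, fun i => ?_⟩
  · have : W y = ∑ i : Fin m, y i • (lp.single 2 (i : ℕ) 1 : L2) :=
      Fintype.linearCombination_apply ..
    rw [this, lp.coeFn_sum, Finset.sum_apply]
    refine Finset.sum_eq_zero fun i _ => ?_
    have : k ≠ i := by omega
    rw [lp.coeFn_smul, Pi.smul_apply, lp.single_apply_ne _ _ _ this, smul_zero]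
  · exact congrFun (LinearMap.mem_ker.1 hy) i

/-- Dimension count: the first `2n + 1` right Schmidt vectors of `a x` span a nonzero `v` satisfying
`2n` linear conditions, namely that `v` and `x v` are orthogonal to the first `n` right Schmidt
vectors of `x` and of `a`. -/
theorem singularValue_mul_le (hH : ¬ FiniteDimensional ℂ H) {a x : H →L[ℂ] H}
    (ha : IsCompactOperator a) (hx : IsCompactOperator x) (n : ℕ) :
    singularValue (a * x) (2 * n) ≤ singularValue a n * singularValue x n := by
  obtain ⟨ha1, ha2, -, e, f, he, hf, haeq⟩ := exists_eq_schmidtOp_singularValue hH ha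
  obtain ⟨hx1, hx2, -, g, h, hg, hh, hxeq⟩ := exists_eq_schmidtOp_singularValue hH hx
  obtain ⟨hz1, hz2, -, p, q, hp, hq, hzeq⟩ :=
    exists_eq_schmidtOp_singularValue hH (x := a * x) (ha.comp_clm x)
  obtain ⟨c, hc0, hc1, hc2⟩ := exists_ne_zero_forall_eq_zero (m := 2 * n + 1) (n := n + n)
    (by omega) (Fin.append
      (fun i => ((innerSL ℂ (g i)).comp (isom hp)).toLinearMap)
      (fun i => ((innerSL ℂ (e i)).comp (x.comp (isom hp))).toLinearMap))
  set v := isom hp c with hv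
  have hvg : ∀ k < n, inner ℂ (g k) v = 0 := fun k hk => by
    have := hc2 (Fin.castAdd n ⟨k, hk⟩)
    rw [Fin.append_left] at this
    exact this
  have hve : ∀ k < n, inner ℂ (e k) (x v) = 0 := fun k hk => by
    have := hc2 (Fin.natAdd n ⟨k, hk⟩)
    rw [Fin.append_right] at this
    exact this
  have h1 : ‖x v‖ ≤ singularValue x n * ‖v‖ := by
    conv_lhs => rw [hxeq]
    exact norm_schmidtOp_le hg hh hx1 hx2 hvg
  have h2 : ‖a (x v)‖ ≤ singularValue a n * ‖x v‖ := by
    conv_lhs => rw [haeq]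
    exact norm_schmidtOp_le he hf ha1 ha2 hve
  have h3 : singularValue (a * x) (2 * n) * ‖c‖ ≤ ‖a (x v)‖ := by
    have : a (x v) = (a * x) v := rfl
    rw [this]
    conv_rhs => rw [hzeq]
    exact le_norm_schmidtOp_isom hp hq hz1 hz2 fun k hk => hc1 k hk
  have hvc : ‖v‖ = ‖c‖ := norm_isom hp c
  refine le_of_mul_le_mul_right ?_ (norm_pos_iff.2 hc0)
  calc _ ≤ singularValue a n * ‖x v‖ := h3.trans h2
    _ ≤ singularValue a n * (singularValue x n * ‖v‖) := mul_le_mul_of_nonneg_left h1 (ha2 n)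
    _ = _ := by rw [hvc, mul_assoc]

end Noncompact

section Ideals

variable {H : Type*} [NormedAddCommGroup H] [InnerProductSpace ℂ H] [CompleteSpace H]

/-! ### Membership in two-sided ideals -/

/-- Compressing by the isometries recovers the bare diagonal, so membership does not depend on the
chosen orthonormal sequences. -/
theorem comp_diag_comp_mem {I : Ideal (H →L[ℂ] H)} (hI : I.IsTwoSided) {e f : ℕ → H}
    (he : Orthonormal ℂ e) (hf : Orthonormal ℂ f) {s : ℕ → ℝ} (hs : schmidtOp he hf s ∈ I)
    (A : L2 →L[ℂ] H) (B : H →L[ℂ] L2) : A ∘L diag s ∘L B ∈ I := by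
  rw [← diag_eq_of_schmidtOp he hf s]
  exact I.mul_mem_right (isom he ∘L B)
    (I.mul_mem_left (A ∘L ContinuousLinearMap.adjoint (isom hf)) hs)

theorem reindex_diag_eq {s : ℕ → ℝ} (hs : SeqBounded s) {σ : ℕ → ℕ}
    (hσ : Function.Injective σ) (h0 : ∀ k ∉ Set.range σ, s k = 0) :
    reindex hσ ∘L diag (s ∘ σ) ∘L ContinuousLinearMap.adjoint (reindex hσ) = diag s := by
  refine continuousLinearMap_ext_single fun k => ?_
  rw [ContinuousLinearMap.comp_apply, ContinuousLinearMap.comp_apply, reindex_diag_single hs,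
    diag_single hs]
  split_ifs with h
  · rfl
  · simp [h0 k h]

theorem diag_even_add_odd {s : ℕ → ℝ} (hs : SeqBounded s)
    (h0 : Function.Injective fun n : ℕ => 2 * n) (h1 : Function.Injective fun n : ℕ => 2 * n + 1) :
    reindex h0 ∘L diag (s ∘ fun n => 2 * n) ∘L ContinuousLinearMap.adjoint (reindex h0) +
      reindex h1 ∘L diag (s ∘ fun n => 2 * n + 1) ∘L ContinuousLinearMap.adjoint (reindex h1) =
      diag s := by
  refine continuousLinearMap_ext_single fun k => ?_
  rw [add_apply, ContinuousLinearMap.comp_apply,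
    ContinuousLinearMap.comp_apply, ContinuousLinearMap.comp_apply,
    ContinuousLinearMap.comp_apply, reindex_diag_single hs, reindex_diag_single hs, diag_single hs]
  rcases Nat.even_or_odd' k with ⟨m, rfl | rfl⟩
  · rw [if_pos ⟨m, rfl⟩, if_neg, add_zero]
    rintro ⟨j, hj⟩
    simp only at hj
    omega
  · rw [if_neg, if_pos ⟨m, rfl⟩, zero_add]
    rintro ⟨j, hj⟩
    simp only at hj
    omega

/-- Diagonal operators dominated by an element of the ideal belong to the ideal. -/
theorem comp_diag_comp_mem_of_le {I : Ideal (H →L[ℂ] H)} (hI : I.IsTwoSided) {e f : ℕ → H}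
    (he : Orthonormal ℂ e) (hf : Orthonormal ℂ f) {s t : ℕ → ℝ} (hs : schmidtOp he hf s ∈ I)
    (hsb : SeqBounded s) (hts : ∀ n, |t n| ≤ |s n|) (A : L2 →L[ℂ] H) (B : H →L[ℂ] L2) :
    A ∘L diag t ∘L B ∈ I := by
  -- Where `s n = 0` the quotient is `0` by convention, which is harmless because `t n = 0` there.
  have hr : SeqBounded fun n => t n / s n := ⟨1, fun n => by
    rw [abs_div]
    exact div_le_one_of_le₀ (hts n) (abs_nonneg _)⟩
  have : t = (fun n => t n / s n) * s := by
    funext n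
    by_cases h : s n = 0
    · have := hts n
      rw [h, abs_zero] at this
      rw [Pi.mul_apply, h, mul_zero, abs_nonpos_iff.1 this]
    · exact (div_mul_cancel₀ _ h).symm
  rw [this, ← diag_comp_diag hr hsb]
  exact comp_diag_comp_mem hI he hf hs (A ∘L diag fun n => t n / s n) B

/-- The even and the odd terms of `s(z)` are each dominated by `s(y)`, the odd ones by monotonicity,
so `z` splits into two operators of the ideal. -/
theorem mem_of_singularValue_two_mul_le (hH : ¬ FiniteDimensional ℂ H) {I : Ideal (H →L[ℂ] H)}
    (hI : I.IsTwoSided) {y z : H →L[ℂ] H} (hy : y ∈ I) (hyc : IsCompactOperator y)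
    (hz : IsCompactOperator z) (h : ∀ n, singularValue z (2 * n) ≤ singularValue y n) : z ∈ I := by
  obtain ⟨hy1, hy2, hy3, e, f, he, hf, hyeq⟩ := exists_eq_schmidtOp_singularValue hH hyc
  obtain ⟨hz1, hz2, hz3, p, q, hp, hq, hzeq⟩ := exists_eq_schmidtOp_singularValue hH hz
  have h0 : Function.Injective fun n : ℕ => 2 * n := fun m n h => by
    simp only at h
    omega
  have h1 : Function.Injective fun n : ℕ => 2 * n + 1 := fun m n h => by
    simp only at h
    omega
  have hyI : schmidtOp he hf (singularValue y) ∈ I := hyeq ▸ hy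
  rw [hzeq, schmidtOp, ← diag_even_add_odd (SeqBounded.of_tendsto hz3) h0 h1,
    ContinuousLinearMap.add_comp, ContinuousLinearMap.comp_add]
  refine I.add_mem ?_ ?_
  · refine comp_diag_comp_mem_of_le hI he hf hyI (SeqBounded.of_tendsto hy3) (fun n => ?_)
      (isom hq ∘L reindex h0)
      (ContinuousLinearMap.adjoint (reindex h0) ∘L ContinuousLinearMap.adjoint (isom hp))
    rw [abs_of_nonneg (hy2 n), Function.comp_apply, abs_of_nonneg (hz2 _)]
    exact h n
  · refine comp_diag_comp_mem_of_le hI he hf hyI (SeqBounded.of_tendsto hy3) (fun n => ?_)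
      (isom hq ∘L reindex h1)
      (ContinuousLinearMap.adjoint (reindex h1) ∘L ContinuousLinearMap.adjoint (isom hp))
    rw [abs_of_nonneg (hy2 n), Function.comp_apply, abs_of_nonneg (hz2 _)]
    exact (hz1 (Nat.le_succ _)).trans (h n)

/-- The diagonal operator of a sequence in `E_I` belongs to `I`. -/
theorem schmidtOp_mem_of_mem_seqSpace (hH : ¬ FiniteDimensional ℂ H) {I : Ideal (H →L[ℂ] H)}
    (hI : I.IsTwoSided) (hIc : ∀ x ∈ I, IsCompactOperator x) {η : ℕ → ℝ} (hη : η ∈ seqSpace I)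
    {e f : ℕ → H} (he : Orthonormal ℂ e) (hf : Orthonormal ℂ f) : schmidtOp he hf η ∈ I := by
  obtain ⟨hη0, x, hx, hxη⟩ := hη
  obtain ⟨σ, hσ, hanti, hzero⟩ := exists_injective_antitone hη0
  obtain ⟨-, -, hx3, g, h, hg, hh, hxeq⟩ := exists_eq_schmidtOp_singularValue hH (hIc x hx)
  have hsx : singularValue x = fun n => |η (σ n)| := by
    rw [← hxη, rearrangement_comp hσ hzero]
    exact rearrangement_eq_self hanti fun n => abs_nonneg _
  have hxI : schmidtOp hg hh (singularValue x) ∈ I := hxeq ▸ hx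
  rw [schmidtOp, ← reindex_diag_eq (SeqBounded.of_tendsto hη0) hσ hzero]
  refine comp_diag_comp_mem_of_le hI hg hh hxI (SeqBounded.of_tendsto hx3) (fun n => ?_)
    (isom hf ∘L reindex hσ)
    (ContinuousLinearMap.adjoint (reindex hσ) ∘L ContinuousLinearMap.adjoint (isom he))
  rw [hsx, abs_abs]
  rfl

/-! ### The dual space of two ideals -/

/-- If `B a C = 1` on `L2` and `V = isom hf` has range containing that of `x`, then `x = V B (a (C
V* x))`, where `C V* x ∈ I`. A noncompact `a` would thus force `I ≤ J`. -/
theorem isCompactOperator_of_mem_dualSpace (hH : ¬ FiniteDimensional ℂ H)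
    {I J : Ideal (H →L[ℂ] H)}
    (hIc : ∀ x ∈ I, IsCompactOperator x) (hIJ : ¬ I ≤ J) {a : H →L[ℂ] H}
    (ha : a ∈ dualSpace J I) : IsCompactOperator a := by
  by_contra hac
  apply hIJ
  intro x hx
  obtain ⟨B, C, hBC⟩ := exists_comp_eq_id_of_not_isCompactOperator hac
  obtain ⟨-, -, -, e, f, he, hf, hxeq⟩ := exists_eq_schmidtOp_singularValue hH (hIc x hx)
  have h1 : (C ∘L ContinuousLinearMap.adjoint (isom hf)) * x ∈ I := I.mul_mem_left _ hx
  have h2 := J.mul_mem_left (isom hf ∘L B) (ha _ h1)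
  convert h2 using 1
  rw [hxeq]
  ext v
  have h3 : ∀ w, B (a (C w)) = w := fun w => DFunLike.congr_fun hBC w
  show _ = isom hf (B (a (C (ContinuousLinearMap.adjoint (isom hf) (schmidtOp he hf _ v)))))
  rw [h3, schmidtOp_apply, adjoint_isom_isom]

theorem dualSpace_eq_operatorSpace (hH : ¬ FiniteDimensional ℂ H) {I J : Ideal (H →L[ℂ] H)}
    (hI : I.IsTwoSided) (hJ : J.IsTwoSided) (hIc : ∀ x ∈ I, IsCompactOperator x)
    (hJc : ∀ x ∈ J, IsCompactOperator x) (hIJ : ¬ I ≤ J) :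
    dualSpace J I = operatorSpace H (seqDual (seqSpace J) (seqSpace I)) := by
  ext a
  constructor
  · intro ha
    have hac := isCompactOperator_of_mem_dualSpace hH hIc hIJ ha
    obtain ⟨-, -, hlim, e, f, he, hf, haeq⟩ := exists_eq_schmidtOp_singularValue hH hac
    have hb := SeqBounded.of_tendsto hlim
    refine ⟨hac, memℓp_infty ?_, fun η hη => ?_⟩
    · obtain ⟨C, hC⟩ := hb
      exact ⟨C, by rintro _ ⟨n, rfl⟩; exact hC n⟩
    · have hlim' : Tendsto (singularValue a * η) atTop (𝓝 0) := by
        have := hlim.mul hη.1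
        rwa [zero_mul] at this
      -- Placing `η` along the right Schmidt vectors of `a` makes the product diagonal.
      refine ⟨hlim', _, ha _ (schmidtOp_mem_of_mem_seqSpace hH hI hIc hη he he), ?_⟩
      have : a * schmidtOp he he η = schmidtOp he hf (singularValue a * η) := by
        rw [← schmidtOp_comp_schmidtOp he he hf hb (SeqBounded.of_tendsto hη.1), ← haeq]
        rfl
      rw [this, singularValue_schmidtOp he hf hlim']
  · rintro ⟨hac, -, ha⟩ x hx
    obtain ⟨ha1, ha2, -⟩ := exists_eq_schmidtOp_singularValue hH hac
    obtain ⟨hx1, hx2, hx3, -⟩ := exists_eq_schmidtOp_singularValue hH (hIc x hx)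
    obtain ⟨-, y, hy, hyeq⟩ := ha _ ⟨hx3, x, hx, rearrangement_eq_self hx1 hx2⟩
    refine mem_of_singularValue_two_mul_le hH hJ hy (hJc y hy) (hac.comp_clm x) fun n => ?_
    rw [← hyeq, rearrangement_eq_self]
    · exact singularValue_mul_le hH hac (hIc x hx) n
    · exact fun m n hmn => mul_le_mul (ha1 hmn) (hx1 hmn) (hx2 n) (ha2 m)
    · exact fun n => mul_nonneg (ha2 n) (hx2 n)

end Ideals
end
end QuasiBanachIdeals

theorem proposition4p3 {H : Type*} [NormedAddCommGroup H] [InnerProductSpace ℂ H]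
    [CompleteSpace H] (hH : ¬ FiniteDimensional ℂ H)
    (I J : Ideal (H →L[ℂ] H)) (qI : I → ℝ) (qJ : J → ℝ)
    (hI : QuasiBanachIdeals.IsSymmetricQuasiBanachIdeal I qI)
    (hJ : QuasiBanachIdeals.IsSymmetricQuasiBanachIdeal J qJ)
    (hIJ : ¬ I ≤ J) :
    QuasiBanachIdeals.dualSpace J I =
      QuasiBanachIdeals.operatorSpace H
        (QuasiBanachIdeals.seqDual (QuasiBanachIdeals.seqSpace J)
          (QuasiBanachIdeals.seqSpace I)) :=
  QuasiBanachIdeals.dualSpace_eq_operatorSpace hH hI.twoSided hJ.twoSided hI.compact hJ.compact hIJ
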